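/- Let $n\le m$, let $\mu=\mathcal N(m_0,\Sigma_0)$ be a Gaussian measure on $\mathbb R^m$ with $\Sigma_0$ non-singular, and let $\nu=\mathcal N(m_1,\Sigma_1)$ be a (possibly degenerate) Gaussian measure on $\mathbb R^n$. Let $\Sigma_0=P_0D_0P_0^T$ and $\Sigma_1=P_1D_1P_1^T$ be any diagonalizations with $P_0,P_1$ orthogonal and $D_0,D_1$ diagonal with diagonal entries sorted in decreasing order. For an $m\times m$ matrix $M$, let $M^{(n)}$ denote the submatrix of its first $n$ rows and first $n$ columns, and let $\|M\|_F=\sqrt{\operatorname{tr}(M^TM)}$. Consider the Gromov-Wasserstein problem restricted to Gaussian couplings, $$GGW_2^2(\mu,\nu)=\inf_{\pi}\iint\left(\|x-x'\|^2-\|y-y'\|^2\right)^2\,d\pi(x,y)\,d\pi(x',y'),$$ where the norms are Euclidean and the infimum is over all (possibly degenerate) Gaussian measures $\pi$ on $\mathbb R^m\times\mathbb R^n$ with marginals $\mu$ and $\nu$. Then, for every choice of signs $\tilde I_n=\operatorname{diag}(\pm1,\dots,\pm1)\in\mathbb R^{n\times n}$, the measure $\pi^*=(\mathrm{Id},T)_{\#}\mu$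 is a minimizer of this problem (in particular it is a Gaussian coupling of $\mu$ and $\nu$), where $T:\mathbb R^m\to\mathbb R^n$ is the affine map $$T(x)=m_1+P_1AP_0^T(x-m_0),\qquad A=\begin{pmatrix}\tilde I_n D_1^{1/2}\,(D_0^{(n)})^{-1/2} & 0_{n,m-n}\end{pmatrix}\in\mathbb R^{n\times m}.$$ Moreover, the optimal value is finite and equals $$GGW_2^2(\mu,\nu)=4\left(\operatorname{tr}D_0-\operatorname{tr}D_1\right)^2+8\,\|D_0^{(n)}-D_1\|_F^2+8\left(\|D_0\|_F^2-\|D_0^{(n)}\|_F^2\right).$$ -/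

import Mathlib

open MeasureTheory ProbabilityTheory
open scoped ENNReal Matrix

namespace GaussianGW

noncomputable section

/-- The Euclidean space `ℝᵈ`. -/
abbrev E (d : ℕ) : Type := EuclideanSpace ℝ (Fin d)

/-- The set `Π(μ, ν)` of couplings (transport plans) of `μ` and `ν`. -/
def couplings {m n : ℕ} (μ : Measure (E m)) (ν : Measure (E n)) : Set (Measure (E m × E n)) :=
  {π | π.map Prod.fst = μ ∧ π.map Prod.snd = ν}

/-- The Gaussian couplings of `μ` and `ν`; Gaussian measures may be degenerate. -/
def gaussianCouplings {m n : ℕ} (μ : Measure (E m)) (ν : Measure (E n)) :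
    Set (Measure (E m × E n)) :=
  {π | π ∈ couplings μ ν ∧ IsGaussian π}

/-- The Gromov-Wasserstein objective
`∫∫ (‖x - x'‖² - ‖y - y'‖²)² dπ(x, y) dπ(x', y')`, with values in `[0, ∞]`. -/
def gwCost {m n : ℕ} (π : Measure (E m × E n)) : ℝ≥0∞ :=
  ∫⁻ p, ∫⁻ q, ENNReal.ofReal ((‖p.1 - q.1‖ ^ 2 - ‖p.2 - q.2‖ ^ 2) ^ 2) ∂π ∂π

/-- `GGW₂²(μ, ν)`: the infimum of the Gromov-Wasserstein objective over Gaussian couplings. -/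
def ggwSq {m n : ℕ} (μ : Measure (E m)) (ν : Measure (E n)) : ℝ≥0∞ :=
  ⨅ π ∈ gaussianCouplings μ ν, gwCost π

/-- `π` solves the Gromov-Wasserstein problem restricted to Gaussian couplings. -/
def IsGGWSolution {m n : ℕ} (μ : Measure (E m)) (ν : Measure (E n))
    (π : Measure (E m × E n)) : Prop :=
  π ∈ gaussianCouplings μ ν ∧ ∀ π' ∈ gaussianCouplings μ ν, gwCost π ≤ gwCost π'

/-- `M = P D Pᵀ` with `P` orthogonal and `D = diag d`, the eigenvalues being sorted in
decreasing order. -/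
def IsSortedDiagonalization {k : ℕ} (M P : Matrix (Fin k) (Fin k) ℝ) (d : Fin k → ℝ) : Prop :=
  P ∈ Matrix.orthogonalGroup (Fin k) ℝ ∧ Antitone d ∧ M = P * Matrix.diagonal d * Pᵀ

/-- `M⁽ⁿ⁾`: the submatrix of the first `n` rows and the first `n` columns of `M`. -/
def leadingBlock {m n : ℕ} (h : n ≤ m) (M : Matrix (Fin m) (Fin m) ℝ) :
    Matrix (Fin n) (Fin n) ℝ :=
  M.submatrix (Fin.castLE h) (Fin.castLE h)

/-- The `n × m` matrix `(B 0)`, for `B` of size `n × n`. -/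
def padCols {n : ℕ} (m : ℕ) (B : Matrix (Fin n) (Fin n) ℝ) : Matrix (Fin n) (Fin m) ℝ :=
  Matrix.of fun i j => if hj : (j : ℕ) < n then B i ⟨j, hj⟩ else 0

/-- The Frobenius norm `√(tr(Mᵀ M))`. -/
def frobeniusNorm {k l : ℕ} (M : Matrix (Fin k) (Fin l) ℝ) : ℝ :=
  √(Mᵀ * M).trace

/-- The matrix `A = (Ĩₙ D₁^{1/2} (D₀⁽ⁿ⁾)^{-1/2} 0)` for `Ĩₙ = diag ε`, `D₀ = diag d₀` and
`D₁ = diag d₁`. -/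
def alignMatrix {m n : ℕ} (h : n ≤ m) (d₀ : Fin m → ℝ) (d₁ ε : Fin n → ℝ) :
    Matrix (Fin n) (Fin m) ℝ :=
  padCols m (Matrix.diagonal ε * Matrix.diagonal (fun i => √(d₁ i)) *
    Matrix.diagonal (fun i => (√(d₀ (Fin.castLE h i)))⁻¹))

/-- The affine map `T(x) = m₁ + P₁ A P₀ᵀ (x - m₀)`. -/
def affineMap {m n : ℕ} (m₀ : E m) (m₁ : E n) (P₀ : Matrix (Fin m) (Fin m) ℝ)
    (P₁ : Matrix (Fin n) (Fin n) ℝ) (A : Matrix (Fin n) (Fin m) ℝ) (x : E m) : E n :=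
  m₁ + WithLp.toLp 2 ((P₁ * A * P₀ᵀ) *ᵥ (x - m₀).ofLp)

end

end GaussianGW

/-!
# Gromov-Wasserstein distance between Gaussian measures, restricted to Gaussian couplings

For two independent samples `(x, y)`, `(x', y')` of a Gaussian coupling `π`, the difference
`(x - x', y - y')` is a centred Gaussian vector with twice the covariance of `π`
(`covarianceBilinDual_differenceLaw`). The cost is the second moment of the quadratic form
`‖x - x'‖² - ‖y - y'‖²`, which Isserlis' formula (`integral_sq_mul_sq`) evaluates to
`4 (tr D₀ - tr D₁)² + 8 ‖D₀‖_F² + 8 ‖D₁‖_F² - 16 ‖K‖_F²`, where `K` is the cross covariance of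
`P₀ᵀ x` and `P₁ᵀ y` (`gwCost_eq`). The problem is thus to maximise `‖K‖_F²`.

As the covariance form of `π` is positive semidefinite, Bessel's inequality shows that the weights
`Kᵢⱼ² / (d₀ᵢ d₁ⱼ)` form a substochastic matrix, and a rearrangement inequality, proved by an
explicit dual solution of the transport linear programme (`exists_dual_certificate`), gives
`‖K‖_F² ≤ ∑ d₀ⱼ d₁ⱼ` (`sum_sq_le_of_isPosSemidef`). No inverse square root of a covariance is
needed, so `ν` may be degenerate. The graph of the affine map has `K = D₀ Aᵀ`, with entries
`εⱼ √(d₀ⱼ d₁ⱼ)` on the diagonal and zeros elsewhere, hence equality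
(`gwCost_map_graph_affineMap`).
-/

namespace GaussianGW

/-! ### Rearrangement and cross covariances -/

/-- A feasible dual solution `(u, v)`, `v = a b - u`, of the linear programme of maximising
`∑ aᵢ bⱼ wᵢⱼ` over substochastic `w`: both potentials dominate the products `aᵢ bⱼ` and are tight
on the diagonal. -/
lemma exists_dual_certificate {a b : ℕ → ℝ} (n : ℕ) (ha : Antitone a) (hb : Antitone b)
    (hb0 : ∀ k, 0 ≤ b k) (hbn : ∀ k, n ≤ k → b k = 0) :
    ∃ u : ℕ → ℝ, (∀ i, 0 ≤ u i) ∧ (∀ i, n ≤ i → u i = 0) ∧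
      ∀ i j, a i * b j ≤ u i + (a j * b j - u j) := by
  -- Abel summation of `∑ b (Δa)` from `i` on; the potential `v = a b - u` is then `∑ (Δb) a`.
  set u : ℕ → ℝ := fun i => ∑ k ∈ Finset.Ico i n, b k * (a k - a (k + 1)) with hu
  have hun : ∀ i, n ≤ i → u i = 0 := fun i hi => by simp [hu, Finset.Ico_eq_empty_of_le hi]
  have hrec : ∀ j, u j = b j * (a j - a (j + 1)) + u (j + 1) := by
    intro j
    rcases lt_or_ge j n with hj | hj
    · simp only [hu]
      rw [Finset.sum_eq_sum_Ico_succ_bot hj]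
    · rw [hun j hj, hun (j + 1) (by omega), hbn j hj]; simp
  refine ⟨u, fun i => Finset.sum_nonneg fun k _ =>
    mul_nonneg (hb0 k) (sub_nonneg.2 (ha (Nat.le_succ k))), hun, fun i j => ?_⟩
  rcases le_total i j with hij | hij
  · suffices h : b j * (a i - a j) ≤ u i - u j by linarith
    induction j, hij using Nat.le_induction with
    | base => simp
    | succ j hij ih =>
      have h1 := hrec j
      have h2 : 0 ≤ (b j - b (j + 1)) * (a i - a (j + 1)) :=
        mul_nonneg (sub_nonneg.2 (hb (Nat.le_succ j))) (sub_nonneg.2 (ha (by omega)))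
      linarith
  · suffices h : a i * (b j - b i) ≤ (a j * b j - u j) - (a i * b i - u i) by linarith
    induction i, hij using Nat.le_induction with
    | base => simp
    | succ i hij ih =>
      have h1 := hrec i
      have h2 : 0 ≤ (a i - a (i + 1)) * (b j - b i) :=
        mul_nonneg (sub_nonneg.2 (ha (Nat.le_succ i))) (sub_nonneg.2 (hb hij))
      linarith

/-- Rearrangement inequality for a substochastic matrix of weights, by weak duality. -/
lemma sum_mul_le_of_substochastic {m n : ℕ} (hnm : n ≤ m) {a : Fin m → ℝ} {b : Fin n → ℝ}
    (ha : Antitone a) (hb : Antitone b) (ha0 : ∀ i, 0 ≤ a i) (hb0 : ∀ j, 0 ≤ b j)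
    {w : Fin m → Fin n → ℝ} (hw : ∀ i j, 0 ≤ w i j) (hrow : ∀ i, ∑ j, w i j ≤ 1)
    (hcol : ∀ j, ∑ i, w i j ≤ 1) :
    ∑ i, ∑ j, a i * b j * w i j ≤ ∑ j, a (Fin.castLE hnm j) * b j := by
  -- Both sequences are continued by zero to sequences on `ℕ`.
  have ext_anti : ∀ {k : ℕ} {c : Fin k → ℝ}, Antitone c → (∀ i, 0 ≤ c i) →
      Antitone (fun l : ℕ => if h : l < k then c ⟨l, h⟩ else 0) := by
    intro k c hc hc0 x y hxy
    dsimp only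
    split_ifs with h1 h2 h2
    · exact hc (by simpa using hxy)
    · omega
    · exact hc0 _
    · exact le_rfl
  obtain ⟨u, hu0, hun, huv⟩ := exists_dual_certificate n (ext_anti ha ha0) (ext_anti hb hb0)
    (fun k => by split_ifs <;> simp [hb0]) (fun k hk => by simp [hk])
  have hdual : ∀ (i : Fin m) (j : Fin n),
      a i * b j ≤ u i + (a (Fin.castLE hnm j) * b j - u j) := fun i j => by
    simpa [j.2.trans_le hnm, Fin.castLE] using huv i j
  have hv0 : ∀ j : Fin n, 0 ≤ a (Fin.castLE hnm j) * b j - u j := fun j => by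
    refine le_trans ?_ (by simpa [j.2.trans_le hnm, Fin.castLE, hun n le_rfl] using huv n j)
    split_ifs
    · exact mul_nonneg (ha0 _) (hb0 j)
    · exact le_rfl
  have hsum : ∑ i : Fin m, u i = ∑ j : Fin n, u j := by
    rw [Fin.sum_univ_eq_sum_range u m, Fin.sum_univ_eq_sum_range u n]
    refine (Finset.sum_subset (Finset.range_mono hnm) fun k _ hk =>
      hun k (by simpa using hk)).symm
  calc ∑ i, ∑ j, a i * b j * w i j
      ≤ ∑ i : Fin m, ∑ j : Fin n, (u i + (a (Fin.castLE hnm j) * b j - u j)) * w i j :=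
        Finset.sum_le_sum fun i _ => Finset.sum_le_sum fun j _ =>
          mul_le_mul_of_nonneg_right (hdual i j) (hw i j)
    _ = ∑ i : Fin m, (u i * ∑ j, w i j)
        + ∑ j : Fin n, ((a (Fin.castLE hnm j) * b j - u j) * ∑ i, w i j) := by
        simp_rw [add_mul, Finset.sum_add_distrib, Finset.mul_sum]
        congr 1
        exact Finset.sum_comm
    _ ≤ ∑ i : Fin m, u i + ∑ j : Fin n, (a (Fin.castLE hnm j) * b j - u j) :=
        add_le_add
          (Finset.sum_le_sum fun i _ => mul_le_of_le_one_right (hu0 i) (hrow i))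
          (Finset.sum_le_sum fun j _ => mul_le_of_le_one_right (hv0 j) (hcol j))
    _ = ∑ j, a (Fin.castLE hnm j) * b j := by rw [hsum, Finset.sum_sub_distrib]; ring

/-- Bessel's inequality for a positive semidefinite form and an orthogonal family `y`. Vectors with
`d j = 0` are allowed: their terms are `0` by the convention `t / 0 = 0`. -/
lemma sum_sq_div_le {V ι : Type*} [AddCommGroup V] [Module ℝ V] [Fintype ι] [DecidableEq ι]
    {C : LinearMap.BilinForm ℝ V} (hC : C.IsPosSemidef) {y : ι → V} {d : ι → ℝ}
    (hy : ∀ j l, C (y j) (y l) = if j = l then d j else 0) (x : V) :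
    ∑ j, C x (y j) ^ 2 / d j ≤ C x x := by
  -- Positivity on `x` minus its projection to the span of the `y j`.
  have hCS := hC.nonneg (x - ∑ j, (C x (y j) / d j) • y j)
  have hsymm : ∀ j, C (y j) x = C x (y j) := fun j => hC.eq _ _
  have h0 : ∀ j, C x (y j) / d j * (C x (y j) / d j * d j) = C x (y j) ^ 2 / d j := fun j => by
    by_cases h : d j = 0
    · simp [h]
    · field_simp
  have h1 : ∀ j, C x (y j) / d j * C x (y j) = C x (y j) ^ 2 / d j := fun j => by ring
  simp only [map_sub, LinearMap.sub_apply, map_sum, LinearMap.coe_sum, Finset.sum_apply, map_smul,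
    LinearMap.smul_apply, smul_eq_mul, hsymm, hy, mul_ite, mul_zero, Finset.sum_ite_eq',
    Finset.mem_univ, if_true, mul_sub, Finset.sum_sub_distrib, h0, h1] at hCS
  linarith

/-- The cross covariances of two orthogonal families with sorted variances `a` and `b` satisfy
`‖K‖_F² ≤ ∑ aⱼ bⱼ`: the weights `Kᵢⱼ² / (aᵢ bⱼ)` are substochastic by Bessel's inequality. -/
lemma sum_sq_le_of_isPosSemidef {V : Type*} [AddCommGroup V] [Module ℝ V] {m n : ℕ}
    (hnm : n ≤ m) {C : LinearMap.BilinForm ℝ V} (hC : C.IsPosSemidef)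
    {x : Fin m → V} {y : Fin n → V} {a : Fin m → ℝ} {b : Fin n → ℝ}
    (ha : Antitone a) (hb : Antitone b)
    (hx : ∀ i k, C (x i) (x k) = if i = k then a i else 0)
    (hy : ∀ j l, C (y j) (y l) = if j = l then b j else 0) :
    ∑ i, ∑ j, C (x i) (y j) ^ 2 ≤ ∑ j, a (Fin.castLE hnm j) * b j := by
  have ha0 : ∀ i, 0 ≤ a i := fun i => by simpa [hx] using hC.nonneg (x i)
  have hb0 : ∀ j, 0 ≤ b j := fun j => by simpa [hy] using hC.nonneg (y j)
  have hsymm : ∀ i j, C (y j) (x i) = C (x i) (y j) := fun i j => hC.eq _ _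
  have hCS : ∀ i j, C (x i) (y j) ^ 2 ≤ a i * b j := fun i j => by
    have := LinearMap.BilinForm.apply_mul_apply_le_of_forall_zero_le C hC.nonneg (x i) (y j)
    simpa [hsymm, hx, hy, sq] using this
  have hw : ∀ i j, a i * b j * (C (x i) (y j) ^ 2 / (a i * b j)) = C (x i) (y j) ^ 2 := by
    intro i j
    by_cases h : a i * b j = 0
    · -- A vanishing variance forces a vanishing covariance, so no mass is lost to `t / 0 = 0`.
      have := hCS i j
      rw [h] at this ⊢
      nlinarith [sq_nonneg (C (x i) (y j))]
    · exact mul_div_cancel₀ _ h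
  calc ∑ i, ∑ j, C (x i) (y j) ^ 2
      = ∑ i, ∑ j, a i * b j * (C (x i) (y j) ^ 2 / (a i * b j)) := by simp_rw [hw]
    _ ≤ _ := by
        refine sum_mul_le_of_substochastic hnm ha hb ha0 hb0
          (fun i j => div_nonneg (sq_nonneg _) (mul_nonneg (ha0 i) (hb0 j))) (fun i => ?_)
          (fun j => ?_)
        · simp_rw [mul_comm (a i), ← div_div, ← Finset.sum_div]
          refine div_le_one_of_le₀ ?_ (ha0 i)
          simpa [hx] using sum_sq_div_le hC hy (x i)
        · simp_rw [← div_div, ← Finset.sum_div]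
          refine div_le_one_of_le₀ ?_ (hb0 j)
          simpa [hy, hsymm] using sum_sq_div_le hC hx (y j)

/-! ### Fourth moments of Gaussian measures and the cost -/

lemma integral_pow_four_gaussianReal (v : NNReal) :
    ∫ x, x ^ 4 ∂(gaussianReal 0 v) = 3 * (v : ℝ) ^ 2 := by
  -- Differentiating a polynomial multiple of the moment generating function.
  have hstep : ∀ g g' : ℝ → ℝ, (∀ t, HasDerivAt g (g' t) t) →
      deriv (fun t => g t * Real.exp (v * t ^ 2 / 2)) =
        fun t => (g' t + v * t * g t) * Real.exp (v * t ^ 2 / 2) := by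
    intro g g' hg
    ext t
    have h2 : HasDerivAt (fun t : ℝ => (v : ℝ) * t ^ 2 / 2) (v * t) t := by
      convert! (((hasDerivAt_id t).pow 2).const_mul (v : ℝ)).div_const 2 using 1
      simp; ring
    rw [((hg t).fun_mul h2.exp).deriv]
    ring
  have hmgf : mgf (fun x => x) (gaussianReal 0 v) =
      fun t => (1 : ℝ) * Real.exp (v * t ^ 2 / 2) := by
    rw [mgf_fun_id_gaussianReal]; simp
  have hmoment : ∫ x, x ^ 4 ∂(gaussianReal 0 v) =
      iteratedDeriv 4 (mgf (fun x => x) (gaussianReal 0 v)) 0 := by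
    rw [iteratedDeriv_mgf_zero] <;> simp
  rw [hmoment, hmgf]
  simp only [iteratedDeriv_succ, iteratedDeriv_zero]
  rw [hstep (fun _ => 1) (fun _ => 0) (fun t => hasDerivAt_const t 1),
    hstep _ (fun _ => v) (fun t => by simpa using (hasDerivAt_id t).const_mul (v : ℝ)),
    hstep _ (fun t => 2 * v ^ 2 * t) (fun t => by
      convert! (((hasDerivAt_id t).pow 2).const_mul ((v : ℝ) ^ 2)).const_add (v : ℝ) using 1
      · ext t; simp; ring
      · simp; ring),
    hstep _ (fun t => 3 * v ^ 2 + 3 * v ^ 3 * t ^ 2) (fun t => by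
      convert! ((hasDerivAt_id t).const_mul (3 * (v : ℝ) ^ 2)).add
        (((hasDerivAt_id t).pow 3).const_mul ((v : ℝ) ^ 3)) using 1
      · ext t; simp; ring
      · simp; ring)]
  simp

section Moments

variable {F : Type*} [NormedAddCommGroup F] [NormedSpace ℝ F] [MeasurableSpace F] [BorelSpace F]

lemma integrable_sq_mul_sq (ρ : Measure F) [IsGaussian ρ] (L M : StrongDual ℝ F) :
    Integrable (fun z => L z ^ 2 * M z ^ 2) ρ := by
  have h : ∀ N : StrongDual ℝ F, MemLp (fun z => N z ^ 2) 2 ρ := fun N => by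
    have := (IsGaussian.memLp_dual ρ N 4 (by simp)).norm_rpow_div (q := 2)
    convert! this using 1
    · ext z; simp
    · rw [show (4 : ℝ≥0∞) = 2 * 2 by norm_num, ENNReal.mul_div_cancel_right] <;> simp
  exact (h L).integrable_mul (h M)

variable [SecondCountableTopology F]

/-- The law of the difference of two independent samples of `π`. -/
noncomputable def differenceLaw (π : Measure F) : Measure F :=
  (π.prod π).map fun r => r.1 - r.2

instance isGaussian_differenceLaw (π : Measure F) [IsGaussian π] : IsGaussian (differenceLaw π) :=
  isGaussian_map (ContinuousLinearMap.fst ℝ F F - ContinuousLinearMap.snd ℝ F F)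

lemma integral_dual_differenceLaw (π : Measure F) [IsGaussian π] (L : StrongDual ℝ F) :
    (differenceLaw π)[L] = 0 := by
  have hL : Integrable L π := IsGaussian.integrable_dual π L
  rw [differenceLaw, integral_map (by fun_prop) (by fun_prop)]
  simp only [map_sub]
  rw [integral_sub (hL.comp_fst π) (hL.comp_snd π), integral_fun_fst, integral_fun_snd]
  simp

variable [CompleteSpace F]

lemma integral_pow_four {ρ : Measure F} [IsGaussian ρ] (L : StrongDual ℝ F) (hL : ρ[L] = 0) :
    ∫ z, L z ^ 4 ∂ρ = 3 * covarianceBilinDual ρ L L ^ 2 := by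
  have h := integral_map (μ := ρ) (φ := L) (f := fun x : ℝ => x ^ 4) (by fun_prop) (by fun_prop)
  rw [← h, IsGaussian.map_eq_gaussianReal, hL, integral_pow_four_gaussianReal,
    covarianceBilinDual_self_eq_variance IsGaussian.memLp_two_id,
    Real.coe_toNNReal _ (variance_nonneg _ _)]

/-- Isserlis' formula for two linear functionals, obtained from the fourth moments of `L`, `M`,
`L + M` and `L - M` by polarisation. -/
lemma integral_sq_mul_sq {ρ : Measure F} [IsGaussian ρ] (hρ : ∀ L : StrongDual ℝ F, ρ[L] = 0)
    (L M : StrongDual ℝ F) :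
    ∫ z, L z ^ 2 * M z ^ 2 ∂ρ = covarianceBilinDual ρ L L * covarianceBilinDual ρ M M
      + 2 * covarianceBilinDual ρ L M ^ 2 := by
  have hadd := integral_pow_four (L + M) (hρ _)
  have hsub := integral_pow_four (L - M) (hρ _)
  have hLL := integral_pow_four L (hρ _)
  have hMM := integral_pow_four M (hρ _)
  have i4 : ∀ N : StrongDual ℝ F, Integrable (fun z => N z ^ 4) ρ := fun N => by
    convert! integrable_sq_mul_sq ρ N N using 2; ring
  have hint : ∫ z, L z ^ 2 * M z ^ 2 ∂ρ = 12⁻¹ * (∫ z, (L + M) z ^ 4 ∂ρ + ∫ z, (L - M) z ^ 4 ∂ρ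
      - 2 * (∫ z, L z ^ 4 ∂ρ + ∫ z, M z ^ 4 ∂ρ)) := by
    rw [← integral_add (i4 _) (i4 _), ← integral_add (i4 _) (i4 _), ← integral_const_mul,
      ← integral_sub ((i4 _).fun_add (i4 _)) (((i4 _).fun_add (i4 _)).const_mul _),
      ← integral_const_mul]
    congr 1 with z
    simp only [add_apply, sub_apply]
    ring
  rw [hint, hadd, hsub, hLL, hMM]
  simp only [map_add, map_sub, add_apply, sub_apply,
    covarianceBilinDual_comm M L]
  ring

/-- The second moment of a quadratic form `∑ cₛ Lₛ²` under a centred Gaussian law. -/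
lemma integral_sum_mul_sq_sq {ρ : Measure F} [IsGaussian ρ] (hρ : ∀ L : StrongDual ℝ F, ρ[L] = 0)
    {ι : Type*} [Fintype ι] (c : ι → ℝ) (L : ι → StrongDual ℝ F) :
    Integrable (fun z => (∑ s, c s * L s z ^ 2) ^ 2) ρ ∧
    ∫ z, (∑ s, c s * L s z ^ 2) ^ 2 ∂ρ = (∑ s, c s * covarianceBilinDual ρ (L s) (L s)) ^ 2
      + 2 * ∑ s, ∑ t, c s * c t * covarianceBilinDual ρ (L s) (L t) ^ 2 := by
  have hexp : (fun z => (∑ s, c s * L s z ^ 2) ^ 2) =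
      fun z => ∑ s, ∑ t, c s * c t * (L s z ^ 2 * L t z ^ 2) := by
    ext z
    rw [sq, Finset.sum_mul_sum]
    exact Finset.sum_congr rfl fun s _ => Finset.sum_congr rfl fun t _ => by ring
  have hi : ∀ s t, Integrable (fun z => c s * c t * (L s z ^ 2 * L t z ^ 2)) ρ :=
    fun s t => (integrable_sq_mul_sq ρ _ _).const_mul _
  have hi' : ∀ s, Integrable (fun z => ∑ t, c s * c t * (L s z ^ 2 * L t z ^ 2)) ρ :=
    fun s => integrable_finsetSum _ fun t _ => hi s t
  rw [hexp]
  refine ⟨integrable_finsetSum _ fun s _ => hi' s, ?_⟩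
  rw [integral_finsetSum _ fun s _ => hi' s, sq, Finset.sum_mul_sum, Finset.mul_sum,
    ← Finset.sum_add_distrib]
  refine Finset.sum_congr rfl fun s _ => ?_
  rw [integral_finsetSum _ fun t _ => hi s t, Finset.mul_sum, ← Finset.sum_add_distrib]
  refine Finset.sum_congr rfl fun t _ => ?_
  rw [integral_const_mul, integral_sq_mul_sq hρ]
  ring

lemma covarianceBilinDual_differenceLaw (π : Measure F) [IsGaussian π] (L M : StrongDual ℝ F) :
    covarianceBilinDual (differenceLaw π) L M = 2 * covarianceBilinDual π L M := by
  have h2 : ∀ N : StrongDual ℝ F, MemLp N 2 π := fun N => IsGaussian.memLp_dual π N 2 (by simp)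
  have hfst : cov[fun r : F × F => L r.1, fun r => M r.1; π.prod π] = cov[L, M; π] := by
    conv_rhs => rw [← (measurePreserving_fst (μ := π) (ν := π)).map_eq]
    rw [covariance_map (by fun_prop) (by fun_prop) (by fun_prop)]
    rfl
  have hsnd : cov[fun r : F × F => L r.2, fun r => M r.2; π.prod π] = cov[L, M; π] := by
    conv_rhs => rw [← (measurePreserving_snd (μ := π) (ν := π)).map_eq]
    rw [covariance_map (by fun_prop) (by fun_prop) (by fun_prop)]
    rfl
  have hmix : ∀ N N' : StrongDual ℝ F,
      cov[fun r : F × F => N r.1, fun r => N' r.2; π.prod π] = 0 := fun N N' =>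
    (indepFun_prod (by fun_prop) (by fun_prop)).covariance_eq_zero
      ((h2 N).comp_fst π) ((h2 N').comp_snd π)
  rw [covarianceBilinDual_eq_covariance IsGaussian.memLp_two_id,
    covarianceBilinDual_eq_covariance IsGaussian.memLp_two_id, differenceLaw,
    covariance_map_fun (by fun_prop) (by fun_prop) (by fun_prop)]
  simp only [map_sub]
  rw [covariance_fun_sub_fun_sub ((h2 L).comp_fst π) ((h2 L).comp_snd π) ((h2 M).comp_fst π)
    ((h2 M).comp_snd π), hfst, hsnd, hmix,
    covariance_comm (fun r : F × F => L r.2), hmix]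
  ring

end Moments

/-- The cost of a Gaussian measure in coordinates which diagonalize the covariances of both
marginals: only the cross covariances of `x` and `y` are not determined by the marginals. -/
lemma gwCost_eq {m n : ℕ} (π : Measure (E m × E n)) [IsGaussian π]
    {x : Fin m → StrongDual ℝ (E m × E n)} {y : Fin n → StrongDual ℝ (E m × E n)}
    (hx : ∀ z, ‖z.1‖ ^ 2 = ∑ i, x i z ^ 2) (hy : ∀ z, ‖z.2‖ ^ 2 = ∑ j, y j z ^ 2)
    {a : Fin m → ℝ} {b : Fin n → ℝ}
    (ha : ∀ i k, covarianceBilinDual π (x i) (x k) = if i = k then a i else 0)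
    (hb : ∀ j l, covarianceBilinDual π (y j) (y l) = if j = l then b j else 0) :
    gwCost π = ENNReal.ofReal (4 * (∑ i, a i - ∑ j, b j) ^ 2 + 8 * ∑ i, a i ^ 2
      + 8 * ∑ j, b j ^ 2 - 16 * ∑ i, ∑ j, covarianceBilinDual π (x i) (y j) ^ 2) := by
  -- The cost is the second moment of the form `∑ xᵢ² - ∑ yⱼ²` under `differenceLaw π`.
  set c : Fin m ⊕ Fin n → ℝ := Sum.elim (fun _ => 1) (fun _ => -1)
  set L : Fin m ⊕ Fin n → StrongDual ℝ (E m × E n) := Sum.elim x y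
  have hQ : ∀ z : E m × E n, ‖z.1‖ ^ 2 - ‖z.2‖ ^ 2 = ∑ s, c s * L s z ^ 2 := fun z => by
    simp [c, L, hx, hy, Fintype.sum_sum_type, sub_eq_add_neg]
  obtain ⟨hint, hval⟩ := integral_sum_mul_sq_sq (integral_dual_differenceLaw π) c L
  have hcost : gwCost π = ∫⁻ z, ENNReal.ofReal ((∑ s, c s * L s z ^ 2) ^ 2) ∂differenceLaw π := by
    rw [differenceLaw, lintegral_map (by fun_prop) (by fun_prop), lintegral_prod _ (by fun_prop),
      gwCost]
    simp only [← hQ, Prod.fst_sub, Prod.snd_sub]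
  rw [hcost, ← ofReal_integral_eq_lintegral_ofReal hint (.of_forall fun z => sq_nonneg _), hval]
  congr 1
  have hyx : ∑ j, ∑ i, covarianceBilinDual π (y j) (x i) ^ 2 =
      ∑ i, ∑ j, covarianceBilinDual π (x i) (y j) ^ 2 := by
    rw [Finset.sum_comm]
    simp only [covarianceBilinDual_comm (y _) (x _)]
  have hxx : ∑ i, ∑ k, covarianceBilinDual π (x i) (x k) ^ 2 = ∑ i, a i ^ 2 := by simp [ha]
  have hyy : ∑ j, ∑ l, covarianceBilinDual π (y j) (y l) ^ 2 = ∑ j, b j ^ 2 := by simp [hb]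
  simp only [covarianceBilinDual_differenceLaw, Fintype.sum_sum_type, c, L, Sum.elim_inl,
    Sum.elim_inr, mul_pow, Finset.sum_add_distrib, ← Finset.mul_sum, hyx, hxx, hyy]
  simp only [ha, hb, if_true]
  ring

/-! ### Coordinates diagonalizing the marginals -/

/-- The functional `x ↦ (Pᵀ x)ᵢ`, the `i`-th coordinate in the basis of the columns of `P`. -/
noncomputable def rotatedCoord {k : ℕ} (P : Matrix (Fin k) (Fin k) ℝ) (i : Fin k) :
    StrongDual ℝ (E k) :=
  innerSL ℝ (WithLp.toLp 2 (Pᵀ i))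

lemma rotatedCoord_apply {k : ℕ} (P : Matrix (Fin k) (Fin k) ℝ) (i : Fin k) (x : E k) :
    rotatedCoord P i x = (Pᵀ *ᵥ x.ofLp) i := by
  simp [rotatedCoord, PiLp.inner_apply, Matrix.mulVec, dotProduct, mul_comm]

lemma norm_sq_eq_sum_rotatedCoord {k : ℕ} {P : Matrix (Fin k) (Fin k) ℝ}
    (hP : P ∈ Matrix.orthogonalGroup (Fin k) ℝ) (x : E k) :
    ‖x‖ ^ 2 = ∑ i, rotatedCoord P i x ^ 2 := by
  have hPP : P * Pᵀ = 1 := (Matrix.mem_orthogonalGroup_iff _ _).1 hP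
  have h : (Pᵀ *ᵥ x.ofLp) ⬝ᵥ (Pᵀ *ᵥ x.ofLp) = x.ofLp ⬝ᵥ x.ofLp := by
    rw [Matrix.dotProduct_mulVec, Matrix.vecMul_transpose, Matrix.mulVec_mulVec, hPP,
      Matrix.one_mulVec]
  rw [EuclideanSpace.real_norm_sq_eq]
  simpa [rotatedCoord_apply, dotProduct, sq] using h.symm

lemma covarianceBilinDual_multivariateGaussian {k : ℕ} {c : E k} {S : Matrix (Fin k) (Fin k) ℝ}
    (hS : S.PosSemidef) (u v : E k) :
    covarianceBilinDual (multivariateGaussian c S) (innerSL ℝ u) (innerSL ℝ v) =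
      u.ofLp ⬝ᵥ S *ᵥ v.ofLp :=
  covarianceBilin_multivariateGaussian hS u v

lemma covarianceBilinDual_rotatedCoord {k : ℕ} {c : E k} {S P : Matrix (Fin k) (Fin k) ℝ}
    {d : Fin k → ℝ} (hS : S.PosSemidef) (h : IsSortedDiagonalization S P d) (i j : Fin k) :
    covarianceBilinDual (multivariateGaussian c S) (rotatedCoord P i) (rotatedCoord P j) =
      if i = j then d i else 0 := by
  have hPP : Pᵀ * P = 1 := (Matrix.mem_orthogonalGroup_iff' _ _).1 h.1
  have hD : Pᵀ * (S * P) = Matrix.diagonal d := by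
    rw [h.2.2]
    calc Pᵀ * (P * Matrix.diagonal d * Pᵀ * P)
        = (Pᵀ * P) * Matrix.diagonal d * (Pᵀ * P) := by simp only [Matrix.mul_assoc]
      _ = _ := by simp [hPP]
  rw [rotatedCoord, rotatedCoord, covarianceBilinDual_multivariateGaussian hS,
    ← Matrix.diagonal_apply, ← hD]
  rfl

lemma IsSortedDiagonalization.nonneg {k : ℕ} {S P : Matrix (Fin k) (Fin k) ℝ} {d : Fin k → ℝ}
    (h : IsSortedDiagonalization S P d) (hS : S.PosSemidef) (i : Fin k) : 0 ≤ d i := by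
  have := covarianceBilinDual_rotatedCoord (c := 0) hS h i i
  rw [if_pos rfl] at this
  exact this ▸ covarianceBilinDual_self_nonneg _

lemma covarianceBilinDual_map {F G : Type*} [NormedAddCommGroup F] [NormedSpace ℝ F]
    [CompleteSpace F] [SecondCountableTopology F] [MeasurableSpace F] [BorelSpace F]
    [NormedAddCommGroup G] [NormedSpace ℝ G]
    [CompleteSpace G] [SecondCountableTopology G] [MeasurableSpace G] [BorelSpace G]
    (π : Measure F) [IsGaussian π] (A : F →L[ℝ] G) (L M : StrongDual ℝ G) :
    covarianceBilinDual (π.map A) L M = covarianceBilinDual π (L ∘L A) (M ∘L A) := by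
  rw [covarianceBilinDual_eq_covariance IsGaussian.memLp_two_id,
    covarianceBilinDual_eq_covariance IsGaussian.memLp_two_id,
    covariance_map (by fun_prop) (by fun_prop) (by fun_prop)]
  rfl

/-! ### The lower bound over Gaussian couplings -/

section Couplings

variable {m n : ℕ} {m₀ : E m} {m₁ : E n} {S₀ P₀ : Matrix (Fin m) (Fin m) ℝ}
  {S₁ P₁ : Matrix (Fin n) (Fin n) ℝ} {d₀ : Fin m → ℝ} {d₁ : Fin n → ℝ}

/-- The coordinate `rotatedCoord P₀ i` of the first component. -/
noncomputable abbrev fstCoord (n : ℕ) (P₀ : Matrix (Fin m) (Fin m) ℝ) (i : Fin m) :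
    StrongDual ℝ (E m × E n) :=
  rotatedCoord P₀ i ∘L .fst ℝ (E m) (E n)

/-- The coordinate `rotatedCoord P₁ j` of the second component. -/
noncomputable abbrev sndCoord (m : ℕ) (P₁ : Matrix (Fin n) (Fin n) ℝ) (j : Fin n) :
    StrongDual ℝ (E m × E n) :=
  rotatedCoord P₁ j ∘L .snd ℝ (E m) (E n)

lemma covarianceBilinDual_fstCoord (hS₀ : S₀.PosSemidef)
    (h₀ : IsSortedDiagonalization S₀ P₀ d₀) {ν : Measure (E n)} {π : Measure (E m × E n)}
    (hπ : π ∈ gaussianCouplings (multivariateGaussian m₀ S₀) ν) (i k : Fin m) :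
    covarianceBilinDual π (fstCoord n P₀ i) (fstCoord n P₀ k) = if i = k then d₀ i else 0 := by
  have := hπ.2
  rw [← covarianceBilinDual_map, ContinuousLinearMap.coe_fst', hπ.1.1,
    covarianceBilinDual_rotatedCoord hS₀ h₀]

lemma covarianceBilinDual_sndCoord (hS₁ : S₁.PosSemidef)
    (h₁ : IsSortedDiagonalization S₁ P₁ d₁) {μ : Measure (E m)} {π : Measure (E m × E n)}
    (hπ : π ∈ gaussianCouplings μ (multivariateGaussian m₁ S₁)) (j l : Fin n) :
    covarianceBilinDual π (sndCoord m P₁ j) (sndCoord m P₁ l) = if j = l then d₁ j else 0 := by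
  have := hπ.2
  rw [← covarianceBilinDual_map, ContinuousLinearMap.coe_snd', hπ.1.2,
    covarianceBilinDual_rotatedCoord hS₁ h₁]

lemma gwCost_eq_of_mem_gaussianCouplings (hS₀ : S₀.PosSemidef) (hS₁ : S₁.PosSemidef)
    (h₀ : IsSortedDiagonalization S₀ P₀ d₀) (h₁ : IsSortedDiagonalization S₁ P₁ d₁)
    {π : Measure (E m × E n)}
    (hπ : π ∈ gaussianCouplings (multivariateGaussian m₀ S₀) (multivariateGaussian m₁ S₁)) :
    gwCost π = ENNReal.ofReal (4 * (∑ i, d₀ i - ∑ j, d₁ j) ^ 2 + 8 * ∑ i, d₀ i ^ 2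
      + 8 * ∑ j, d₁ j ^ 2
      - 16 * ∑ i, ∑ j, covarianceBilinDual π (fstCoord n P₀ i) (sndCoord m P₁ j) ^ 2) := by
  have := hπ.2
  have hx : ∀ z : E m × E n, ‖z.1‖ ^ 2 = ∑ i, fstCoord n P₀ i z ^ 2 :=
    fun z => norm_sq_eq_sum_rotatedCoord h₀.1 z.1
  have hy : ∀ z : E m × E n, ‖z.2‖ ^ 2 = ∑ j, sndCoord m P₁ j z ^ 2 :=
    fun z => norm_sq_eq_sum_rotatedCoord h₁.1 z.2
  exact gwCost_eq π hx hy (covarianceBilinDual_fstCoord hS₀ h₀ hπ)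
    (covarianceBilinDual_sndCoord hS₁ h₁ hπ)

/-- The cost of a Gaussian coupling whose cross covariance has the largest Frobenius norm
possible, `‖K‖_F² = ∑ d₀ⱼ d₁ⱼ`. -/
noncomputable def optimalValue (hnm : n ≤ m) (d₀ : Fin m → ℝ) (d₁ : Fin n → ℝ) : ℝ :=
  4 * (∑ i, d₀ i - ∑ j, d₁ j) ^ 2 + 8 * ∑ i, d₀ i ^ 2 + 8 * ∑ j, d₁ j ^ 2
    - 16 * ∑ j, d₀ (Fin.castLE hnm j) * d₁ j

/-- The lower bound: no Gaussian coupling costs less than `optimalValue`. -/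
lemma optimalValue_le_gwCost (hnm : n ≤ m) (hS₀ : S₀.PosSemidef) (hS₁ : S₁.PosSemidef)
    (h₀ : IsSortedDiagonalization S₀ P₀ d₀) (h₁ : IsSortedDiagonalization S₁ P₁ d₁)
    {π : Measure (E m × E n)}
    (hπ : π ∈ gaussianCouplings (multivariateGaussian m₀ S₀) (multivariateGaussian m₁ S₁)) :
    ENNReal.ofReal (optimalValue hnm d₀ d₁) ≤ gwCost π := by
  have hK : ∑ i, ∑ j, covarianceBilinDual π (fstCoord n P₀ i) (sndCoord m P₁ j) ^ 2 ≤
      ∑ j, d₀ (Fin.castLE hnm j) * d₁ j :=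
    sum_sq_le_of_isPosSemidef hnm (isPosSemidef_covarianceBilinDual (μ := π)) h₀.2.1 h₁.2.1
      (covarianceBilinDual_fstCoord hS₀ h₀ hπ) (covarianceBilinDual_sndCoord hS₁ h₁ hπ)
  rw [gwCost_eq_of_mem_gaussianCouplings hS₀ hS₁ h₀ h₁ hπ, optimalValue]
  exact ENNReal.ofReal_le_ofReal (by linarith)

end Couplings

/-! ### Affine images of Gaussian measures -/

lemma alignMatrix_apply {m n : ℕ} (hnm : n ≤ m) (d₀ : Fin m → ℝ) (d₁ ε : Fin n → ℝ) (j : Fin n)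
    (i : Fin m) : alignMatrix hnm d₀ d₁ ε j i =
      if i = Fin.castLE hnm j then ε j * √(d₁ j) * (√(d₀ i))⁻¹ else 0 := by
  simp only [alignMatrix, padCols, Matrix.of_apply, Matrix.diagonal_mul_diagonal,
    Matrix.diagonal_apply]
  by_cases h : i = Fin.castLE hnm j
  · subst h; simp
  · rw [if_neg h]
    split_ifs with h1 h2
    · exact absurd (Fin.ext (by simp [h2])) h
    · rfl
    · rfl

/-- Multiplication by the matrix `B` as a continuous linear map between Euclidean spaces. -/
noncomputable def matrixCLM {m n : ℕ} (B : Matrix (Fin n) (Fin m) ℝ) : E m →L[ℝ] E n :=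
  LinearMap.toContinuousLinearMap (Matrix.toLpLin 2 2 B)

lemma innerSL_comp_matrixCLM {m n : ℕ} (B : Matrix (Fin n) (Fin m) ℝ) (v : E n) :
    (innerSL ℝ v) ∘L matrixCLM B = innerSL ℝ (WithLp.toLp 2 (Bᵀ *ᵥ v.ofLp)) := by
  ext x
  simp only [matrixCLM, ContinuousLinearMap.comp_apply, innerSL_apply_apply,
    LinearMap.coe_toContinuousLinearMap', Matrix.toLpLin_apply,
    EuclideanSpace.inner_eq_star_dotProduct, star_trivial]
  rw [dotProduct_comm, Matrix.dotProduct_mulVec, Matrix.mulVec_transpose, dotProduct_comm]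

lemma affineMap_eq {m n : ℕ} (m₀ : E m) (m₁ : E n) (P₀ : Matrix (Fin m) (Fin m) ℝ)
    (P₁ : Matrix (Fin n) (Fin n) ℝ) (A : Matrix (Fin n) (Fin m) ℝ) (x : E m) :
    affineMap m₀ m₁ P₀ P₁ A x =
      (m₁ - matrixCLM (P₁ * A * P₀ᵀ) m₀) + matrixCLM (P₁ * A * P₀ᵀ) x := by
  rw [affineMap, sub_add_eq_add_sub, add_sub_assoc, ← map_sub]
  rfl

/-- An affine map with linear part `B` that matches the means pushes `N(m₀, S₀)` forward to
`N(m₁, B S₀ Bᵀ)`. -/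
lemma map_affine_multivariateGaussian {m n : ℕ} {m₀ : E m} {m₁ : E n}
    {S₀ : Matrix (Fin m) (Fin m) ℝ} {S₁ : Matrix (Fin n) (Fin n) ℝ} (hS₀ : S₀.PosSemidef)
    (hS₁ : S₁.PosSemidef) {B : Matrix (Fin n) (Fin m) ℝ} (hB : B * S₀ * Bᵀ = S₁) :
    (multivariateGaussian m₀ S₀).map (fun x => (m₁ - matrixCLM B m₀) + matrixCLM B x) =
      multivariateGaussian m₁ S₁ := by
  have hcomp : (multivariateGaussian m₀ S₀).map
      (fun x => (m₁ - matrixCLM B m₀) + matrixCLM B x) =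
      ((multivariateGaussian m₀ S₀).map (matrixCLM B)).map
        (fun y => (m₁ - matrixCLM B m₀) + y) := by
    rw [Measure.map_map (by fun_prop) (by fun_prop)]; rfl
  rw [hcomp]
  apply IsGaussian.ext
  · rw [integral_map (by fun_prop) (by fun_prop), integral_map (by fun_prop) (by fun_prop)]
    simp only [id_eq]
    rw [integral_add (integrable_const _)
      ((matrixCLM B).integrable_comp IsGaussian.integrable_fun_id),
      (matrixCLM B).integral_comp_comm IsGaussian.integrable_fun_id]
    simp
  · rw [covarianceBilin_map_const_add]
    ext u v
    rw [covarianceBilin_multivariateGaussian hS₁]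
    change covarianceBilinDual _ (innerSL ℝ u) (innerSL ℝ v) = _
    rw [covarianceBilinDual_map, innerSL_comp_matrixCLM, innerSL_comp_matrixCLM,
      covarianceBilinDual_multivariateGaussian hS₀, ← hB]
    simp only [Matrix.mulVec_transpose, ← Matrix.dotProduct_mulVec, Matrix.mulVec_mulVec]
    simp only [← Matrix.mulVec_transpose, Matrix.mulVec_mulVec]

instance isGaussian_map_graph {m n : ℕ} (μ : Measure (E m)) [IsGaussian μ] (c : E n)
    (G : E m →L[ℝ] E n) : IsGaussian (μ.map fun x => (x, c + G x)) := by
  have hcomp : (μ.map fun x => (x, c + G x)) =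
      (μ.map ((ContinuousLinearMap.id ℝ (E m)).prod G)).map
        (fun z => ((0 : E m), c) + z) := by
    rw [Measure.map_map (by fun_prop) (by fun_prop)]
    congr 1
    ext x <;> simp
  rw [hcomp]
  infer_instance

lemma covarianceBilinDual_map_graph {m n : ℕ} (μ : Measure (E m)) [IsGaussian μ] (c : E n)
    (G : E m →L[ℝ] E n) (L : StrongDual ℝ (E m)) (M : StrongDual ℝ (E n)) :
    covarianceBilinDual (μ.map fun x => (x, c + G x)) (L ∘L .fst ℝ _ _) (M ∘L .snd ℝ _ _) =
      covarianceBilinDual μ L (M ∘L G) := by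
  rw [covarianceBilinDual_eq_covariance IsGaussian.memLp_two_id,
    covarianceBilinDual_eq_covariance IsGaussian.memLp_two_id,
    covariance_map_fun (by fun_prop) (by fun_prop) (by fun_prop)]
  simp only [ContinuousLinearMap.comp_apply, ContinuousLinearMap.coe_fst',
    ContinuousLinearMap.coe_snd', map_add]
  exact covariance_const_add_right (IsGaussian.integrable_dual μ (M ∘L G)) _

/-- `A D₀ Aᵀ = D₁`. Positivity of `d₀` makes the inverse square roots in `A` genuine, while `d₁` may
vanish. -/
lemma align_mul_diagonal_mul_transpose {m n : ℕ} (hnm : n ≤ m) {d₀ : Fin m → ℝ}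
    {d₁ ε : Fin n → ℝ} (hd₀ : ∀ i, 0 < d₀ i) (hd₁ : ∀ j, 0 ≤ d₁ j)
    (hε : ∀ j, ε j = 1 ∨ ε j = -1) :
    alignMatrix hnm d₀ d₁ ε * Matrix.diagonal d₀ * (alignMatrix hnm d₀ d₁ ε)ᵀ =
      Matrix.diagonal d₁ := by
  ext j l
  rw [Matrix.mul_apply]
  simp only [Matrix.mul_diagonal, Matrix.transpose_apply, alignMatrix_apply, ite_mul, zero_mul,
    mul_ite, mul_zero, Finset.sum_ite_eq', Finset.mem_univ, if_true, Matrix.diagonal_apply]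
  by_cases h : j = l
  · subst h
    have hε2 : ε j * ε j = 1 := by rcases hε j with h | h <;> simp [h]
    have h0 := hd₀ (Fin.castLE hnm j)
    have h0s : √(d₀ (Fin.castLE hnm j)) ≠ 0 := (Real.sqrt_pos.2 h0).ne'
    have h0m := Real.mul_self_sqrt h0.le
    have h1m := Real.mul_self_sqrt (hd₁ j)
    simp only [if_true]
    field_simp
    rw [sq, sq, sq, hε2, h0m, h1m]
    ring
  · rw [if_neg h, if_neg fun h' => h (Fin.castLE_injective hnm h').symm]

lemma IsSortedDiagonalization.pos {k : ℕ} {S P : Matrix (Fin k) (Fin k) ℝ} {d : Fin k → ℝ}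
    (h : IsSortedDiagonalization S P d) (hS : S.PosSemidef) (hdet : IsUnit S.det) (i : Fin k) :
    0 < d i := by
  refine lt_of_le_of_ne (IsSortedDiagonalization.nonneg h hS i) fun hi => hdet.ne_zero ?_
  rw [h.2.2, Matrix.det_mul, Matrix.det_mul, Matrix.det_diagonal,
    Finset.prod_eq_zero (Finset.mem_univ i) hi.symm]
  simp

/-! ### The optimal couplings -/

section Optimal

variable {m n : ℕ} {m₀ : E m} {m₁ : E n} {S₀ P₀ : Matrix (Fin m) (Fin m) ℝ}
  {S₁ P₁ : Matrix (Fin n) (Fin n) ℝ} {d₀ : Fin m → ℝ} {d₁ ε : Fin n → ℝ}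

lemma map_graph_affineMap_mem_gaussianCouplings (hnm : n ≤ m) (hS₀ : S₀.PosSemidef)
    (hS₀ns : IsUnit S₀.det) (hS₁ : S₁.PosSemidef) (h₀ : IsSortedDiagonalization S₀ P₀ d₀)
    (h₁ : IsSortedDiagonalization S₁ P₁ d₁) (hε : ∀ j, ε j = 1 ∨ ε j = -1) :
    ((multivariateGaussian m₀ S₀).map fun x =>
      (x, affineMap m₀ m₁ P₀ P₁ (alignMatrix hnm d₀ d₁ ε) x)) ∈
      gaussianCouplings (multivariateGaussian m₀ S₀) (multivariateGaussian m₁ S₁) := by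
  set A := alignMatrix hnm d₀ d₁ ε
  have hPP : P₀ᵀ * P₀ = 1 := (Matrix.mem_orthogonalGroup_iff' _ _).1 h₀.1
  have hB : P₁ * A * P₀ᵀ * S₀ * (P₁ * A * P₀ᵀ)ᵀ = S₁ := by
    rw [h₀.2.2, h₁.2.2, ← align_mul_diagonal_mul_transpose hnm
      (IsSortedDiagonalization.pos h₀ hS₀ hS₀ns) (IsSortedDiagonalization.nonneg h₁ hS₁) hε]
    simp only [Matrix.transpose_mul, Matrix.transpose_transpose]
    calc P₁ * A * P₀ᵀ * (P₀ * Matrix.diagonal d₀ * P₀ᵀ) * (P₀ * (Aᵀ * P₁ᵀ))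
        = P₁ * A * (P₀ᵀ * P₀) * Matrix.diagonal d₀ * (P₀ᵀ * P₀) * Aᵀ * P₁ᵀ := by
          simp only [Matrix.mul_assoc]
      _ = P₁ * (A * Matrix.diagonal d₀ * Aᵀ) * P₁ᵀ := by simp [hPP, Matrix.mul_assoc]
  simp only [affineMap_eq]
  refine ⟨⟨?_, ?_⟩, isGaussian_map_graph _ _ _⟩
  · rw [Measure.map_map (by fun_prop) (by fun_prop)]
    exact Measure.map_id
  · rw [Measure.map_map (by fun_prop) (by fun_prop)]
    exact map_affine_multivariateGaussian hS₀ hS₁ hB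

/-- For the graph of the affine map the cross covariance is `D₀ Aᵀ` in rotated coordinates, whose
only nonzero entries are `εⱼ √(d₀ⱼ d₁ⱼ)`; the bound on `‖K‖_F²` is attained. -/
lemma gwCost_map_graph_affineMap (hnm : n ≤ m) (hS₀ : S₀.PosSemidef)
    (hS₀ns : IsUnit S₀.det) (hS₁ : S₁.PosSemidef) (h₀ : IsSortedDiagonalization S₀ P₀ d₀)
    (h₁ : IsSortedDiagonalization S₁ P₁ d₁) (hε : ∀ j, ε j = 1 ∨ ε j = -1) :
    gwCost ((multivariateGaussian m₀ S₀).map fun x =>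
      (x, affineMap m₀ m₁ P₀ P₁ (alignMatrix hnm d₀ d₁ ε) x)) =
      ENNReal.ofReal (optimalValue hnm d₀ d₁) := by
  set A := alignMatrix hnm d₀ d₁ ε with hA
  have hPP₀ : P₀ᵀ * P₀ = 1 := (Matrix.mem_orthogonalGroup_iff' _ _).1 h₀.1
  have hPP₁ : P₁ᵀ * P₁ = 1 := (Matrix.mem_orthogonalGroup_iff' _ _).1 h₁.1
  have hD : P₀ᵀ * (S₀ * ((P₁ * A * P₀ᵀ)ᵀ * P₁)) = Matrix.diagonal d₀ * Aᵀ := by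
    rw [h₀.2.2]
    simp only [Matrix.transpose_mul, Matrix.transpose_transpose]
    calc P₀ᵀ * (P₀ * Matrix.diagonal d₀ * P₀ᵀ * (P₀ * (Aᵀ * P₁ᵀ) * P₁))
        = (P₀ᵀ * P₀) * Matrix.diagonal d₀ * (P₀ᵀ * P₀) * Aᵀ * (P₁ᵀ * P₁) := by
          simp only [Matrix.mul_assoc]
      _ = _ := by simp [hPP₀, hPP₁]
  have hK : ∀ i j, covarianceBilinDual ((multivariateGaussian m₀ S₀).map fun x =>
      (x, affineMap m₀ m₁ P₀ P₁ A x)) (fstCoord n P₀ i) (sndCoord m P₁ j) = d₀ i * A j i := by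
    intro i j
    simp only [affineMap_eq]
    rw [covarianceBilinDual_map_graph, rotatedCoord, rotatedCoord,
      innerSL_comp_matrixCLM, covarianceBilinDual_multivariateGaussian hS₀,
      ← Matrix.transpose_apply A, ← Matrix.diagonal_mul, ← hD]
    rfl
  have hsq : ∀ j, ∑ i, (d₀ i * A j i) ^ 2 = d₀ (Fin.castLE hnm j) * d₁ j := by
    intro j
    simp only [hA, alignMatrix_apply, mul_ite, mul_zero, ite_pow, ne_eq, OfNat.ofNat_ne_zero,
      not_false_eq_true, zero_pow, Finset.sum_ite_eq', Finset.mem_univ, if_true]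
    have hε2 : ε j ^ 2 = 1 := by rcases hε j with h | h <;> simp [h]
    have h0 := IsSortedDiagonalization.pos h₀ hS₀ hS₀ns (Fin.castLE hnm j)
    rw [mul_pow, mul_pow, mul_pow, inv_pow, hε2, Real.sq_sqrt h0.le,
      Real.sq_sqrt (IsSortedDiagonalization.nonneg h₁ hS₁ j)]
    field_simp
  rw [gwCost_eq_of_mem_gaussianCouplings hS₀ hS₁ h₀ h₁
    (map_graph_affineMap_mem_gaussianCouplings hnm hS₀ hS₀ns hS₁ h₀ h₁ hε), optimalValue]
  simp only [← hA, hK]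
  rw [Finset.sum_comm]
  simp only [hsq]

end Optimal

/-! ### The optimal value -/

lemma frobeniusNorm_diagonal_sq {k : ℕ} (d : Fin k → ℝ) :
    frobeniusNorm (Matrix.diagonal d) ^ 2 = ∑ i, d i ^ 2 := by
  have h : ((Matrix.diagonal d)ᵀ * Matrix.diagonal d).trace = ∑ i, d i ^ 2 := by
    simp [Matrix.trace_diagonal, sq]
  rw [frobeniusNorm, h, Real.sq_sqrt (Finset.sum_nonneg fun i _ => sq_nonneg _)]

lemma leadingBlock_diagonal {m n : ℕ} (hnm : n ≤ m) (d : Fin m → ℝ) :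
    leadingBlock hnm (Matrix.diagonal d) = Matrix.diagonal (d ∘ Fin.castLE hnm) :=
  Matrix.submatrix_diagonal _ _ (Fin.castLE_injective hnm)

lemma optimalValue_eq {m n : ℕ} (hnm : n ≤ m) (d₀ : Fin m → ℝ) (d₁ : Fin n → ℝ) :
    optimalValue hnm d₀ d₁ =
      4 * ((Matrix.diagonal d₀).trace - (Matrix.diagonal d₁).trace) ^ 2 +
      8 * frobeniusNorm (leadingBlock hnm (Matrix.diagonal d₀) - Matrix.diagonal d₁) ^ 2 +
      8 * (frobeniusNorm (Matrix.diagonal d₀) ^ 2 -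
        frobeniusNorm (leadingBlock hnm (Matrix.diagonal d₀)) ^ 2) := by
  rw [leadingBlock_diagonal, Matrix.diagonal_sub, frobeniusNorm_diagonal_sq,
    frobeniusNorm_diagonal_sq, frobeniusNorm_diagonal_sq, Matrix.trace_diagonal,
    Matrix.trace_diagonal, optimalValue]
  simp only [Function.comp_apply, sub_sq, Finset.sum_add_distrib, Finset.sum_sub_distrib,
    mul_assoc, ← Finset.mul_sum]
  ring

lemma optimalValue_nonneg {m n : ℕ} (hnm : n ≤ m) (d₀ : Fin m → ℝ) (d₁ : Fin n → ℝ) :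
    0 ≤ optimalValue hnm d₀ d₁ := by
  have h : ∑ j, d₀ (Fin.castLE hnm j) ^ 2 ≤ ∑ i, d₀ i ^ 2 := by
    have := Finset.sum_le_univ_sum_of_nonneg (s := Finset.univ.map (Fin.castLEEmb hnm))
      (f := fun i => d₀ i ^ 2) fun i => sq_nonneg _
    simpa using this
  rw [optimalValue_eq, leadingBlock_diagonal, frobeniusNorm_diagonal_sq (d₀ ∘ _),
    frobeniusNorm_diagonal_sq d₀]
  have := sub_nonneg.2 h
  simp only [Function.comp_apply]
  positivity

end GaussianGW

theorem mainTheorem1 {m n : ℕ} (hnm : n ≤ m)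
    (m₀ : GaussianGW.E m) (m₁ : GaussianGW.E n)
    (S₀ : Matrix (Fin m) (Fin m) ℝ) (S₁ : Matrix (Fin n) (Fin n) ℝ)
    (hS₀ : S₀.PosSemidef) (hS₀ns : IsUnit S₀.det) (hS₁ : S₁.PosSemidef)
    (P₀ : Matrix (Fin m) (Fin m) ℝ) (d₀ : Fin m → ℝ)
    (P₁ : Matrix (Fin n) (Fin n) ℝ) (d₁ : Fin n → ℝ)
    (h₀ : GaussianGW.IsSortedDiagonalization S₀ P₀ d₀)
    (h₁ : GaussianGW.IsSortedDiagonalization S₁ P₁ d₁) :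
    (∀ ε : Fin n → ℝ, (∀ i, ε i = 1 ∨ ε i = -1) →
      GaussianGW.IsGGWSolution (multivariateGaussian m₀ S₀) (multivariateGaussian m₁ S₁)
        ((multivariateGaussian m₀ S₀).map fun x =>
          (x, GaussianGW.affineMap m₀ m₁ P₀ P₁ (GaussianGW.alignMatrix hnm d₀ d₁ ε) x))) ∧
    GaussianGW.ggwSq (multivariateGaussian m₀ S₀) (multivariateGaussian m₁ S₁) ≠ ∞ ∧
    (GaussianGW.ggwSq (multivariateGaussian m₀ S₀) (multivariateGaussian m₁ S₁)).toReal =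
      4 * ((Matrix.diagonal d₀).trace - (Matrix.diagonal d₁).trace) ^ 2 +
      8 * GaussianGW.frobeniusNorm
        (GaussianGW.leadingBlock hnm (Matrix.diagonal d₀) - Matrix.diagonal d₁) ^ 2 +
      8 * (GaussianGW.frobeniusNorm (Matrix.diagonal d₀) ^ 2 -
        GaussianGW.frobeniusNorm (GaussianGW.leadingBlock hnm (Matrix.diagonal d₀)) ^ 2) := by
  have hvalue : GaussianGW.ggwSq (multivariateGaussian m₀ S₀) (multivariateGaussian m₁ S₁) =
      ENNReal.ofReal (GaussianGW.optimalValue hnm d₀ d₁) := by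
    have hone : ∀ j : Fin n, (1 : ℝ) = 1 ∨ (1 : ℝ) = -1 := fun _ => .inl rfl
    refine le_antisymm ?_ (le_iInf₂ fun π hπ =>
      GaussianGW.optimalValue_le_gwCost hnm hS₀ hS₁ h₀ h₁ hπ)
    rw [← GaussianGW.gwCost_map_graph_affineMap (m₀ := m₀) (m₁ := m₁) hnm hS₀ hS₀ns hS₁ h₀ h₁ hone]
    exact iInf₂_le _ (GaussianGW.map_graph_affineMap_mem_gaussianCouplings hnm hS₀ hS₀ns hS₁ h₀ h₁
      hone)
  refine ⟨fun ε hε => ⟨GaussianGW.map_graph_affineMap_mem_gaussianCouplings hnm hS₀ hS₀ns hS₁ h₀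
    h₁ hε, fun π hπ => ?_⟩, ?_, ?_⟩
  · rw [GaussianGW.gwCost_map_graph_affineMap hnm hS₀ hS₀ns hS₁ h₀ h₁ hε]
    exact GaussianGW.optimalValue_le_gwCost hnm hS₀ hS₁ h₀ h₁ hπ
  · rw [hvalue]
    exact ENNReal.ofReal_ne_top
  · rw [hvalue, ENNReal.toReal_ofReal (GaussianGW.optimalValue_nonneg hnm d₀ d₁),
      GaussianGW.optimalValue_eq]
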